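/- Let $\mathcal M\neq 0$ be a finite-dimensional von Neumann algebra with a faithful positive trace $\tau$, and let $\mathcal A,\mathcal B\subseteq\mathcal M$ and $\mathcal R\subseteq\mathcal A\cap\mathcal B$ be unital $*$-subalgebras, each equipped with the trace induced by restricting $\tau$. For a subalgebra $\mathcal N\in\{\mathcal R,\mathcal A,\mathcal B\}$ let $E_{\mathcal N}:\mathcal M\to\mathcal N$ be the trace-preserving conditional expectation, i.e. the adjoint of the inclusion, determined by $\tau(x\,E_{\mathcal N}(\rho))=\tau(x\rho)$ for all $x\in\mathcal N$, $\rho\in\mathcal M$. For $\rho\ge 0$ let $H(\rho)=-\tau(\rho\log\rho)$ (natural logarithm, $0\log 0=0$). Put $$c=\sup\{\tau(ab) : a\in\mathcal A,\ b\in\mathcal B,\ a\ge 0,\ b\ge 0,\ E_{\mathcal R}(a)=1,\ \tau(b)=1\}.$$ Then this supremum is finite (and over a nonempty set), and for every density operator $\rho\in\mathcal M$ (i.e. $\rho\ge 0$, $\tau(\rho)=1$), $$H(E_{\mathcal A}(\rho))+H(E_{\mathcal B}(\rho))\ \ge\ H(\rho)+H(E_{\mathcal R}(\rho))+\log\frac1c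 .$$ Moreover, $c=1$ if and only if $E_{\mathcal A}E_{\mathcal B}=E_{\mathcal B}E_{\mathcal A}=E_{\mathcal R}$ (the commuting square condition). -/

import Mathlib

/-!
Write `D(ρ‖σ) = τ (ρ (log ρ - log σ))`; trace preservation gives `D(ρ‖E_N ρ) = H(E_N ρ) - H(ρ)`.
Rescaling a positive `a ∈ A` by `E_R(a)^(-1/2)` on both sides, and `b ∈ B` by `E_R(a)^(1/2)`, turns
the definition of `c` into the operator inequality `E_B E_A ρ ≤ c • E_R ρ`. With the operator
monotonicity of the logarithm and the monotonicity of `D` under `E_B` this gives, for strictly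
positive `ρ` of trace one,
`H(E_R ρ) - H(E_B ρ) - log c ≤ D(E_B ρ‖E_B E_A ρ) ≤ D(ρ‖E_A ρ) = H(E_A ρ) - H(ρ)`,
and the general case follows by continuity. If `c = 1`, then `E_B E_A ρ ≤ E_R ρ` is an inequality
between elements of equal trace, hence an equality.

`D` decreases under `E_N` by a variational argument: the solution `x` of the Sylvester equation
`a x + x b = y` maximises the concave quadratic form `2 τ(yz) - τ(z⋆ a z) - τ(z b z⋆)`, which for
`z ∈ N` is unchanged when `a`, `b`, `y` are replaced by their conditional expectations, so that
`τ(yx)` can only decrease under `E_N`. Taking `a = (1 - s) σ`, `b = s ρ`, `y = ρ` and integrating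
over `s` from `0` to `1` recovers the relative entropy.
-/

open scoped ComplexOrder

/-- A faithful (positive, tracial) trace on a finite-dimensional von Neumann algebra. -/
structure FaithfulTrace (M : Type*) [CStarAlgebra M] [PartialOrder M] [StarOrderedRing M] where
  /-- the underlying positive linear functional -/
  toFun : M →ₚ[ℂ] ℂ
  tracial : ∀ x y : M, toFun (x * y) = toFun (y * x)
  faithful : ∀ x : M, 0 ≤ x → toFun x = 0 → x = 0

namespace FaithfulTrace

variable {M : Type*} [CStarAlgebra M] [PartialOrder M] [StarOrderedRing M]

noncomputable instance : CoeFun (FaithfulTrace M) (fun _ => M → ℂ) := ⟨fun τ x => τ.toFun x⟩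

/-- For `y` in a subalgebra `N`, the functional `x ↦ τ (x * y)` on `N`, linear in `y`.
It only involves the induced trace `τ|_N`. -/
noncomputable def pairing (τ : FaithfulTrace M) (N : StarSubalgebra ℂ M) : N →ₗ[ℂ] Module.Dual ℂ N :=
  LinearMap.mk₂ ℂ (fun y x : N => τ ((x : M) * (y : M)))
    (by intro y z x; simp [mul_add]) (by intro c y x; simp)
    (by intro y x z; simp [add_mul]) (by intro c y x; simp)

theorem pairing_injective (τ : FaithfulTrace M) (N : StarSubalgebra ℂ M) :
    Function.Injective (τ.pairing N) := by
  rw [injective_iff_map_eq_zero]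
  intro y hy
  have h : τ (star (y : M) * (y : M)) = 0 := by
    have := LinearMap.congr_fun hy (star y)
    simpa [pairing] using this
  have h2 := τ.faithful _ (star_mul_self_nonneg (y : M)) h
  exact Subtype.ext (by simpa using CStarRing.star_mul_self_eq_zero_iff (y : M) |>.1 h2)

variable [FiniteDimensional ℂ M]

/-- The map `ρ ↦ E_N ρ`, `M → N`, adjoint to the inclusion `N ⊆ M` with respect to the traces
`τ` on `M` and `τ|_N` on `N`: for every `x ∈ N`, `τ (x * E_N ρ) = τ (x * ρ)`. -/
noncomputable def adjointInclusion (τ : FaithfulTrace M) (N : StarSubalgebra ℂ M) : M →ₗ[ℂ] N :=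
  haveI : FiniteDimensional ℂ N :=
    inferInstanceAs (FiniteDimensional ℂ (Subalgebra.toSubmodule N.toSubalgebra))
  (LinearEquiv.ofInjectiveOfFinrankEq (τ.pairing N) (τ.pairing_injective N)
      (Subspace.dual_finrank_eq).symm).symm.toLinearMap ∘ₗ
    LinearMap.mk₂ ℂ (fun (ρ : M) (x : N) => τ ((x : M) * ρ))
      (by intro y z x; simp [mul_add]) (by intro c y x; simp)
      (by intro y x z; simp [add_mul]) (by intro c y x; simp)

/-- The trace-preserving conditional expectation `E_N`, regarded as a map `M → M` with values
in `N`. -/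
noncomputable def condExp (τ : FaithfulTrace M) (N : StarSubalgebra ℂ M) : M →ₗ[ℂ] M :=
  N.subtype.toLinearMap ∘ₗ τ.adjointInclusion N

theorem condExp_mem (τ : FaithfulTrace M) (N : StarSubalgebra ℂ M) (ρ : M) :
    τ.condExp N ρ ∈ N := (τ.adjointInclusion N ρ).2

/-- The defining property of the conditional expectation. -/
theorem trace_mul_condExp (τ : FaithfulTrace M) (N : StarSubalgebra ℂ M) (ρ x : M) (hx : x ∈ N) :
    τ (x * τ.condExp N ρ) = τ (x * ρ) := by
  have : FiniteDimensional ℂ N :=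
    inferInstanceAs (FiniteDimensional ℂ (Subalgebra.toSubmodule N.toSubalgebra))
  have h : τ.pairing N (τ.adjointInclusion N ρ) ⟨x, hx⟩ = τ (x * ρ) := by
    have := (LinearEquiv.ofInjectiveOfFinrankEq (τ.pairing N) (τ.pairing_injective N)
      (Subspace.dual_finrank_eq).symm).apply_symm_apply
      (LinearMap.mk₂ ℂ (fun (ρ : M) (x : N) => τ ((x : M) * ρ))
        (by intro y z x; simp [mul_add]) (by intro c y x; simp)
        (by intro y x z; simp [add_mul]) (by intro c y x; simp) ρ)
    exact LinearMap.congr_fun this ⟨x, hx⟩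
  exact h

/-- Density operators: `ρ ≥ 0` and `τ ρ = 1`. -/
def IsDensity (τ : FaithfulTrace M) (ρ : M) : Prop := 0 ≤ ρ ∧ τ ρ = 1

/-- The von Neumann entropy `H(ρ) = -τ (ρ log ρ)`, where `-ρ log ρ` is obtained by functional
calculus from `t ↦ -t log t` (with `0 log 0 = 0`). For an element of a subalgebra it is the
entropy with respect to the induced trace. -/
noncomputable def entropy (τ : FaithfulTrace M) (ρ : M) : ℝ := (τ (cfc Real.negMulLog ρ)).re

/-- The values `τ (a b)` (which are real) with `a ∈ A`, `b ∈ B` positive, `E_R a = 1`,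
`τ b = 1`. -/
def overlapSet (τ : FaithfulTrace M) (R A B : StarSubalgebra ℂ M) : Set ℝ :=
  {t | ∃ a ∈ A, ∃ b ∈ B, 0 ≤ a ∧ 0 ≤ b ∧ τ.condExp R a = 1 ∧ τ b = 1 ∧ τ (a * b) = (t : ℂ)}

/-- The constant `c`, the supremum of the overlaps. -/
noncomputable def overlap (τ : FaithfulTrace M) (R A B : StarSubalgebra ℂ M) : ℝ :=
  sSup (τ.overlapSet R A B)

end FaithfulTrace

section Spectrum

theorem finite_spectrum_of_isIntegral {K A : Type*} [Field K] [Ring A] [Algebra K A] {a : A}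
    (ha : IsIntegral K a) : (spectrum K a).Finite := by
  obtain ⟨p, hp, hpa⟩ := ha
  refine (Polynomial.finite_setOfPred_isRoot hp.ne_zero).subset fun t ht => ?_
  have hmem := spectrum.subset_polynomial_aeval a p ⟨t, ht, rfl⟩
  rcases subsingleton_or_nontrivial A with _ | _
  · simp only [spectrum.of_subsingleton, Set.mem_empty_iff_false] at ht
  · rw [Polynomial.aeval_def, hpa, spectrum.zero_eq, Set.mem_singleton_iff] at hmem
    exact hmem

variable {M : Type*} [CStarAlgebra M] [FiniteDimensional ℂ M]

theorem finite_spectrum_real (a : M) : (spectrum ℝ a).Finite :=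
  finite_spectrum_of_isIntegral (Algebra.IsIntegral.isIntegral a)

theorem continuousOn_spectrum_real (a : M) (f : ℝ → ℝ) : ContinuousOn f (spectrum ℝ a) :=
  (finite_spectrum_real a).continuousOn f

instance isClosed_starSubalgebra (N : StarSubalgebra ℂ M) : IsClosed (N : Set M) :=
  Submodule.closed_of_finiteDimensional (Subalgebra.toSubmodule N.toSubalgebra)

theorem cfc_mul_eq_mul_cfc (f g : ℝ → ℝ) (a : M) :
    cfc (fun t => f t * g t) a = cfc f a * cfc g a :=
  cfc_mul f g a (continuousOn_spectrum_real a f) (continuousOn_spectrum_real a g)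

/-- The real spectrum of an element of a finite-dimensional algebra, as a finset. -/
noncomputable def spectralValues (a : M) : Finset ℝ := (finite_spectrum_real a).toFinset

theorem mem_spectralValues {a : M} {t : ℝ} : t ∈ spectralValues a ↔ t ∈ spectrum ℝ a :=
  (finite_spectrum_real a).mem_toFinset

/-- The spectral projection of a self-adjoint `a` onto the eigenspace of `t`; it is zero when `t`
is not in the spectrum. -/
noncomputable def spectralProj (a : M) (t : ℝ) : M := cfc (Pi.single t (1 : ℝ)) a

theorem spectralProj_mem {N : StarSubalgebra ℂ M} {a : M} (ha : a ∈ N) (t : ℝ) :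
    spectralProj a t ∈ N :=
  cfc_mem (𝕜' := ℂ) _ ha

theorem cfc_eq_sum_spectralProj (f : ℝ → ℝ) (a : M) :
    cfc f a = ∑ t ∈ spectralValues a, f t • spectralProj a t := by
  have hf : (spectrum ℝ a).EqOn f
      (∑ t ∈ spectralValues a, f t • (Pi.single t 1 : ℝ → ℝ)) := fun s hs => by
    simp [Finset.sum_apply, Pi.single_apply, mem_spectralValues.2 hs]
  rw [cfc_congr hf, cfc_sum _ _ _ fun _ _ => continuousOn_spectrum_real a _]
  exact Finset.sum_congr rfl fun t _ =>
    cfc_smul (f t) (Pi.single t 1 : ℝ → ℝ) a (continuousOn_spectrum_real a _)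

theorem mul_spectralProj {a : M} (ha : IsSelfAdjoint a) (t : ℝ) :
    a * spectralProj a t = t • spectralProj a t := by
  have h : a * spectralProj a t = cfc (fun s => s * (Pi.single t 1 : ℝ → ℝ) s) a := by
    rw [cfc_mul_eq_mul_cfc, cfc_id' ℝ a, spectralProj]
  rw [h, spectralProj, ← cfc_smul t _ a (continuousOn_spectrum_real a _)]
  congr! 2 with s
  by_cases hs : s = t <;> simp [hs]

theorem spectralProj_mul {a : M} (ha : IsSelfAdjoint a) (t : ℝ) :
    spectralProj a t * a = t • spectralProj a t := by
  rw [← mul_spectralProj ha]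
  exact ((Commute.refl a).cfc_real _).eq

/-- The double operator integral `∑ s t, f s t • P_s(a) Q_t(b)` over the spectral projections of
two self-adjoint elements, which need not commute. -/
noncomputable def doubleCFC (a b : M) : (ℝ → ℝ → ℝ) →ₗ[ℝ] M where
  toFun f := ∑ s ∈ spectralValues a, ∑ t ∈ spectralValues b,
    f s t • (spectralProj a s * spectralProj b t)
  map_add' f g := by simp [add_smul, Finset.sum_add_distrib]
  map_smul' c f := by simp [mul_smul, Finset.smul_sum]

theorem doubleCFC_apply (a b : M) (f : ℝ → ℝ → ℝ) :
    doubleCFC a b f = ∑ s ∈ spectralValues a, ∑ t ∈ spectralValues b,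
      f s t • (spectralProj a s * spectralProj b t) := rfl

theorem doubleCFC_congr {a b : M} {f g : ℝ → ℝ → ℝ}
    (h : ∀ s ∈ spectrum ℝ a, ∀ t ∈ spectrum ℝ b, f s t = g s t) :
    doubleCFC a b f = doubleCFC a b g :=
  Finset.sum_congr rfl fun s hs => Finset.sum_congr rfl fun t ht => by
    rw [h s (mem_spectralValues.1 hs) t (mem_spectralValues.1 ht)]

theorem doubleCFC_mul (a b : M) (f g : ℝ → ℝ) :
    doubleCFC a b (fun s t => f s * g t) = cfc f a * cfc g b := by
  simp only [doubleCFC_apply, cfc_eq_sum_spectralProj, Finset.sum_mul_sum, smul_mul_smul_comm]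

theorem doubleCFC_snd {a : M} (ha : IsSelfAdjoint a) (b : M) (g : ℝ → ℝ) :
    doubleCFC a b (fun _ t => g t) = cfc g b := by
  simpa only [one_mul, cfc_const_one ℝ a] using doubleCFC_mul a b (fun _ => 1) g

theorem mul_doubleCFC {a : M} (ha : IsSelfAdjoint a) (b : M) (f : ℝ → ℝ → ℝ) :
    a * doubleCFC a b f = doubleCFC a b (fun s t => s * f s t) := by
  simp only [doubleCFC_apply, Finset.mul_sum, mul_smul_comm, ← mul_assoc, mul_spectralProj ha,
    smul_mul_assoc, smul_smul, mul_comm]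

theorem doubleCFC_mul_right (a : M) {b : M} (hb : IsSelfAdjoint b) (f : ℝ → ℝ → ℝ) :
    doubleCFC a b f * b = doubleCFC a b (fun s t => f s t * t) := by
  simp only [doubleCFC_apply, Finset.sum_mul, smul_mul_assoc, mul_assoc, spectralProj_mul hb,
    mul_smul_comm, smul_smul]

theorem doubleCFC_mem {N : StarSubalgebra ℂ M} {a b : M} (ha : a ∈ N) (hb : b ∈ N)
    (f : ℝ → ℝ → ℝ) : doubleCFC a b f ∈ N :=
  sum_mem fun s _ => sum_mem fun t _ =>
    N.toSubmodule.smul_of_tower_mem _ (N.mul_mem (spectralProj_mem ha s) (spectralProj_mem hb t))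

theorem hasDerivAt_doubleCFC {a b : M} {f : ℝ → ℝ → ℝ → ℝ} {f' : ℝ → ℝ → ℝ} {u : ℝ}
    (h : ∀ s ∈ spectrum ℝ a, ∀ t ∈ spectrum ℝ b, HasDerivAt (fun u => f u s t) (f' s t) u) :
    HasDerivAt (fun u => doubleCFC a b (f u)) (doubleCFC a b f') u :=
  HasDerivAt.fun_sum fun s hs => HasDerivAt.fun_sum fun t ht =>
    (h s (mem_spectralValues.1 hs) t (mem_spectralValues.1 ht)).smul_const _

theorem continuousOn_doubleCFC {X : Type*} [TopologicalSpace X] {a b : M} {f : X → ℝ → ℝ → ℝ}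
    {S : Set X} (h : ∀ s ∈ spectrum ℝ a, ∀ t ∈ spectrum ℝ b, ContinuousOn (fun u => f u s t) S) :
    ContinuousOn (fun u => doubleCFC a b (f u)) S :=
  continuousOn_finsetSum _ fun s hs => continuousOn_finsetSum _ fun t ht =>
    (h s (mem_spectralValues.1 hs) t (mem_spectralValues.1 ht)).smul continuousOn_const

/-- The solution `x` of the Sylvester equation `(1 - s) σ x + s x ρ = ρ`. -/
noncomputable def sylvesterSol (σ ρ : M) (s : ℝ) : M :=
  doubleCFC σ ρ fun t r => r / ((1 - s) * t + s * r)

theorem sylvesterSol_mem {N : StarSubalgebra ℂ M} {σ ρ : M} (hσ : σ ∈ N) (hρ : ρ ∈ N) (s : ℝ) :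
    sylvesterSol σ ρ s ∈ N :=
  doubleCFC_mem hσ hρ _

variable [PartialOrder M] [StarOrderedRing M]

theorem smul_mul_sylvesterSol_add {σ ρ : M} (hσ : IsStrictlyPositive σ) (hρ : 0 ≤ ρ) {s : ℝ}
    (hs0 : 0 ≤ s) (hs1 : s < 1) :
    (1 - s) • σ * sylvesterSol σ ρ s + sylvesterSol σ ρ s * s • ρ = ρ := by
  have hρs := IsSelfAdjoint.of_nonneg hρ
  rw [smul_mul_assoc, mul_smul_comm, sylvesterSol, mul_doubleCFC hσ.isSelfAdjoint,
    doubleCFC_mul_right _ hρs, ← map_smul, ← map_smul, ← map_add]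
  refine (doubleCFC_congr fun t ht r hr => ?_).trans
    ((doubleCFC_snd hσ.isSelfAdjoint ρ fun r => r).trans (cfc_id' ℝ ρ))
  have ht0 := hσ.spectrum_pos ht
  have hr0 := spectrum_nonneg_of_nonneg hρ hr
  have hd : (1 - s) * t + s * r ≠ 0 :=
    (add_pos_of_pos_of_nonneg (mul_pos (sub_pos.2 hs1) ht0) (mul_nonneg hs0 hr0)).ne'
  simp only [Pi.add_apply, Pi.smul_apply, smul_eq_mul]
  field_simp

theorem rpow_mem {N : StarSubalgebra ℂ M} {a : M} (ha : 0 ≤ a) (haN : a ∈ N) (y : ℝ) :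
    a ^ y ∈ N := by
  rw [CFC.rpow_eq_cfc_real ha]
  exact cfc_mem (𝕜' := ℂ) _ haN

end Spectrum

namespace FaithfulTrace

section Trace

variable {M : Type*} [CStarAlgebra M] [PartialOrder M] [StarOrderedRing M]

/-- The real part of the trace, as a real-linear functional. It determines the trace on positive
elements, so that all (in)equalities below can be stated in `ℝ`. -/
noncomputable def reTrace (τ : FaithfulTrace M) : M →L[ℝ] ℝ :=
  Complex.reCLM.comp ⟨τ.toFun.toLinearMap.restrictScalars ℝ, map_continuous τ.toFun⟩

theorem reTrace_mul_comm (τ : FaithfulTrace M) (x y : M) :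
    τ.reTrace (x * y) = τ.reTrace (y * x) :=
  congrArg Complex.re (τ.tracial x y)

theorem reTrace_star (τ : FaithfulTrace M) (x : M) : τ.reTrace (star x) = τ.reTrace x :=
  (congrArg Complex.re (map_star τ.toFun x)).trans (Complex.conj_re _)

theorem apply_eq_reTrace (τ : FaithfulTrace M) {x : M} (hx : 0 ≤ x) :
    τ.toFun x = (τ.reTrace x : ℂ) :=
  Complex.ext rfl (Complex.nonneg_iff.1 (map_nonneg τ.toFun hx)).2.symm

theorem reTrace_nonneg (τ : FaithfulTrace M) {x : M} (hx : 0 ≤ x) : 0 ≤ τ.reTrace x :=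
  (Complex.nonneg_iff.1 (map_nonneg τ.toFun hx)).1

theorem eq_zero_of_reTrace_eq_zero (τ : FaithfulTrace M) {x : M} (hx : 0 ≤ x)
    (h : τ.reTrace x = 0) : x = 0 :=
  τ.faithful x hx (by rw [τ.apply_eq_reTrace hx, h, Complex.ofReal_zero])

theorem reTrace_pos (τ : FaithfulTrace M) {x : M} (hx : 0 ≤ x) (hx0 : x ≠ 0) :
    0 < τ.reTrace x :=
  (τ.reTrace_nonneg hx).lt_of_ne fun h => hx0 (τ.eq_zero_of_reTrace_eq_zero hx h.symm)

theorem apply_mul_nonneg (τ : FaithfulTrace M) {x y : M} (hx : 0 ≤ x) (hy : 0 ≤ y) :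
    0 ≤ τ.toFun (x * y) := by
  obtain ⟨z, rfl⟩ := CStarAlgebra.nonneg_iff_eq_star_mul_self.1 hx
  have hcyc : τ.toFun (star z * z * y) = τ.toFun (z * y * star z) := by
    rw [mul_assoc]
    exact τ.tracial _ _
  rw [hcyc]
  exact map_nonneg τ.toFun (star_right_conjugate_nonneg hy z)

theorem apply_mul_eq_reTrace (τ : FaithfulTrace M) {x y : M} (hx : 0 ≤ x) (hy : 0 ≤ y) :
    τ.toFun (x * y) = (τ.reTrace (x * y) : ℂ) :=
  Complex.ext rfl (Complex.nonneg_iff.1 (τ.apply_mul_nonneg hx hy)).2.symm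

theorem reTrace_mul_nonneg (τ : FaithfulTrace M) {x y : M} (hx : 0 ≤ x) (hy : 0 ≤ y) :
    0 ≤ τ.reTrace (x * y) :=
  (Complex.nonneg_iff.1 (τ.apply_mul_nonneg hx hy)).1

theorem reTrace_mul_le_reTrace_mul (τ : FaithfulTrace M) {x y z : M} (hx : 0 ≤ x) (h : y ≤ z) :
    τ.reTrace (x * y) ≤ τ.reTrace (x * z) := by
  rw [← sub_nonneg, ← map_sub, ← mul_sub]
  exact τ.reTrace_mul_nonneg hx (sub_nonneg.2 h)

theorem eq_of_reTrace_mul_eq (τ : FaithfulTrace M) {N : StarSubalgebra ℂ M} {y z : M} (hy : y ∈ N)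
    (hz : z ∈ N) (h : ∀ x ∈ N, τ.reTrace (x * y) = τ.reTrace (x * z)) : y = z := by
  have h0 : τ.reTrace (star (y - z) * (y - z)) = 0 := by
    rw [mul_sub, map_sub, h _ (star_mem (sub_mem hy hz)), sub_self]
  rw [← sub_eq_zero, ← CStarRing.star_mul_self_eq_zero_iff]
  exact τ.eq_zero_of_reTrace_eq_zero (star_mul_self_nonneg _) h0

theorem nonneg_of_reTrace_mul_nonneg (τ : FaithfulTrace M) {N : StarSubalgebra ℂ M}
    [IsClosed (N : Set M)] {y : M} (hy : y ∈ N) (hys : IsSelfAdjoint y)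
    (h : ∀ b ∈ N, 0 ≤ b → 0 ≤ τ.reTrace (b * y)) : 0 ≤ y := by
  have hmem : y⁻ ∈ N := CFC.negPart_def y ▸ cfcₙ_mem (𝕜' := ℂ) _ hy
  have hmul : y⁻ * y = -(star y⁻ * y⁻) := by
    rw [(CFC.negPart_nonneg y).isSelfAdjoint.star_eq]
    nth_rewrite 2 [← CFC.posPart_sub_negPart y]
    rw [mul_sub, CFC.negPart_mul_posPart, zero_sub]
  have hneg := h _ hmem (CFC.negPart_nonneg y)
  rw [hmul, map_neg, neg_nonneg] at hneg
  have hsq := τ.eq_zero_of_reTrace_eq_zero (star_mul_self_nonneg _)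
    (hneg.antisymm (τ.reTrace_nonneg (star_mul_self_nonneg _)))
  exact (CFC.negPart_eq_zero_iff y).1 ((CStarRing.star_mul_self_eq_zero_iff _).1 hsq)

end Trace

section CondExp

variable {M : Type*} [CStarAlgebra M] [PartialOrder M] [StarOrderedRing M] [FiniteDimensional ℂ M]
  (τ : FaithfulTrace M) (N : StarSubalgebra ℂ M)

theorem reTrace_mul_condExp (x : M) {z : M} (hz : z ∈ N) :
    τ.reTrace (z * τ.condExp N x) = τ.reTrace (z * x) :=
  congrArg Complex.re (τ.trace_mul_condExp N x z hz)

theorem condExp_eq_of_reTrace_mul_eq {x y : M} (hy : y ∈ N)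
    (h : ∀ z ∈ N, τ.reTrace (z * y) = τ.reTrace (z * x)) : τ.condExp N x = y :=
  τ.eq_of_reTrace_mul_eq (τ.condExp_mem N x) hy fun z hz => by
    rw [τ.reTrace_mul_condExp N x hz, h z hz]

theorem condExp_of_mem {x : M} (hx : x ∈ N) : τ.condExp N x = x :=
  τ.condExp_eq_of_reTrace_mul_eq N hx fun _ _ => rfl

theorem condExp_one : τ.condExp N 1 = 1 := τ.condExp_of_mem N (one_mem N)

theorem condExp_add_smul_one (x : M) (r : ℝ) :
    τ.condExp N (x + r • 1) = τ.condExp N x + r • 1 := by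
  rw [map_add, LinearMap.map_smul_of_tower, condExp_one]

theorem reTrace_condExp (x : M) : τ.reTrace (τ.condExp N x) = τ.reTrace x := by
  simpa only [one_mul] using τ.reTrace_mul_condExp N x (one_mem N)

theorem reTrace_condExp_mul (x y : M) :
    τ.reTrace (τ.condExp N x * y) = τ.reTrace (x * τ.condExp N y) := by
  rw [← τ.reTrace_mul_condExp N y (τ.condExp_mem N x), τ.reTrace_mul_comm,
    τ.reTrace_mul_condExp N x (τ.condExp_mem N y), τ.reTrace_mul_comm]

theorem condExp_mul_mul {y z : M} (hy : y ∈ N) (hz : z ∈ N) (x : M) :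
    τ.condExp N (y * x * z) = y * τ.condExp N x * z := by
  refine τ.condExp_eq_of_reTrace_mul_eq N
    (mul_mem (mul_mem hy (τ.condExp_mem N x)) hz) fun w hw => ?_
  have hcyc (v : M) : τ.reTrace (w * (y * v * z)) = τ.reTrace (z * w * y * v) := by
    rw [← mul_assoc, τ.reTrace_mul_comm]
    simp only [mul_assoc]
  rw [hcyc, hcyc, τ.reTrace_mul_condExp N x (mul_mem (mul_mem hz hw) hy)]

theorem condExp_star (x : M) : τ.condExp N (star x) = star (τ.condExp N x) := by
  refine τ.condExp_eq_of_reTrace_mul_eq N (star_mem (τ.condExp_mem N x)) fun z hz => ?_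
  have hstar (v : M) : τ.reTrace (z * star v) = τ.reTrace (star z * v) := by
    rw [← reTrace_star, star_mul, star_star, τ.reTrace_mul_comm]
  rw [hstar, hstar, τ.reTrace_mul_condExp N x (star_mem hz)]

theorem condExp_isSelfAdjoint {x : M} (hx : IsSelfAdjoint x) :
    IsSelfAdjoint (τ.condExp N x) := by
  rw [isSelfAdjoint_iff, ← condExp_star, hx.star_eq]

theorem condExp_nonneg {x : M} (hx : 0 ≤ x) : 0 ≤ τ.condExp N x :=
  τ.nonneg_of_reTrace_mul_nonneg (τ.condExp_mem N x) (τ.condExp_isSelfAdjoint N (.of_nonneg hx))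
    fun b hb hb0 => by
      rw [τ.reTrace_mul_condExp N x hb]
      exact τ.reTrace_mul_nonneg hb0 hx

theorem condExp_mono {x y : M} (h : x ≤ y) : τ.condExp N x ≤ τ.condExp N y := by
  rw [← sub_nonneg, ← map_sub]
  exact τ.condExp_nonneg N (sub_nonneg.2 h)

theorem condExp_isStrictlyPositive {x : M} (hx : IsStrictlyPositive x) :
    IsStrictlyPositive (τ.condExp N x) := by
  rcases subsingleton_or_nontrivial M with _ | _
  · rwa [Subsingleton.elim (τ.condExp N x) x]
  obtain ⟨r, hr, hrx⟩ := (CFC.exists_pos_algebraMap_le_iff hx.isSelfAdjoint).2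
    fun _ => hx.spectrum_pos
  have hmem : algebraMap ℝ M r ∈ N := by
    rw [Algebra.algebraMap_eq_smul_one]
    exact N.toSubmodule.smul_of_tower_mem r (one_mem N)
  have hle := τ.condExp_mono N hrx
  rw [τ.condExp_of_mem N hmem] at hle
  exact (isStrictlyPositive_algebraMap hr).of_le hle

variable {N} in
theorem condExp_condExp_of_le {R : StarSubalgebra ℂ M} (hR : R ≤ N) (x : M) :
    τ.condExp R (τ.condExp N x) = τ.condExp R x :=
  τ.condExp_eq_of_reTrace_mul_eq R (τ.condExp_mem R x) fun z hz => by
    rw [τ.reTrace_mul_condExp R x hz, τ.reTrace_mul_condExp N x (hR hz)]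

end CondExp

section Sylvester

variable {M : Type*} [CStarAlgebra M] [PartialOrder M] [StarOrderedRing M]

/-- The concave quadratic form `z ↦ 2 τ(yz) - τ(z⋆ a z) - τ(z b z⋆)`, whose critical points are the
solutions `z` of the Sylvester equation `a z + z b = y`. -/
noncomputable def sylvesterForm (τ : FaithfulTrace M) (a b y z : M) : ℝ :=
  2 * τ.reTrace (y * z) - τ.reTrace (star z * a * z) - τ.reTrace (z * b * star z)

theorem sylvesterForm_add_square (τ : FaithfulTrace M) {a b y x : M} (ha : IsSelfAdjoint a)
    (hb : IsSelfAdjoint b) (hy : IsSelfAdjoint y) (hx : a * x + x * b = y) (z : M) :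
    τ.sylvesterForm a b y z + (τ.reTrace (star (z - x) * a * (z - x)) +
      τ.reTrace ((z - x) * b * star (z - x))) = τ.reTrace (y * x) := by
  have hlin (w : M) : τ.reTrace (star w * a * x) + τ.reTrace (x * b * star w) =
      τ.reTrace (y * w) := by
    rw [τ.reTrace_mul_comm (x * b), mul_assoc, ← map_add, ← mul_add, hx, ← reTrace_star, star_mul,
      star_star, hy.star_eq]
  have hleft : τ.reTrace (star x * a * z) = τ.reTrace (star z * a * x) := by
    rw [← reTrace_star]
    simp only [star_mul, star_star, ha.star_eq, mul_assoc]
  have hright : τ.reTrace (z * b * star x) = τ.reTrace (x * b * star z) := by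
    rw [← reTrace_star]
    simp only [star_mul, star_star, hb.star_eq, mul_assoc]
  have hsol := hlin x
  have hcross := hlin z
  simp only [sylvesterForm, star_sub, sub_mul, mul_sub, map_sub]
  linarith

theorem sylvesterForm_eq_of_sylvester (τ : FaithfulTrace M) {a b y x : M} (ha : IsSelfAdjoint a)
    (hb : IsSelfAdjoint b) (hy : IsSelfAdjoint y) (hx : a * x + x * b = y) :
    τ.sylvesterForm a b y x = τ.reTrace (y * x) := by
  simpa using τ.sylvesterForm_add_square ha hb hy hx x

theorem sylvesterForm_le_of_sylvester (τ : FaithfulTrace M) {a b y x : M} (ha : 0 ≤ a)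
    (hb : 0 ≤ b) (hy : IsSelfAdjoint y) (hx : a * x + x * b = y) (z : M) :
    τ.sylvesterForm a b y z ≤ τ.reTrace (y * x) := by
  rw [← τ.sylvesterForm_add_square (.of_nonneg ha) (.of_nonneg hb) hy hx z]
  exact le_add_of_nonneg_right (add_nonneg
    (τ.reTrace_nonneg (star_left_conjugate_nonneg ha _))
    (τ.reTrace_nonneg (star_right_conjugate_nonneg hb _)))

variable [FiniteDimensional ℂ M]

theorem sylvesterForm_condExp (τ : FaithfulTrace M) (N : StarSubalgebra ℂ M) (a b y : M) {z : M}
    (hz : z ∈ N) : τ.sylvesterForm (τ.condExp N a) (τ.condExp N b) (τ.condExp N y) z =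
      τ.sylvesterForm a b y z := by
  have hlin (v : M) : τ.reTrace (τ.condExp N v * z) = τ.reTrace (v * z) := by
    rw [reTrace_condExp_mul, τ.condExp_of_mem N hz]
  have hquad {u w : M} (hu : u ∈ N) (hw : w ∈ N) (v : M) :
      τ.reTrace (u * τ.condExp N v * w) = τ.reTrace (u * v * w) := by
    rw [← τ.condExp_mul_mul N hu hw, reTrace_condExp]
  rw [sylvesterForm, sylvesterForm, hlin, hquad (star_mem hz) hz, hquad hz (star_mem hz)]

theorem reTrace_condExp_mul_le_of_sylvester (τ : FaithfulTrace M) (N : StarSubalgebra ℂ M)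
    {a b y x x' : M} (ha : 0 ≤ a) (hb : 0 ≤ b) (hy : IsSelfAdjoint y) (hx : a * x + x * b = y)
    (hx'N : x' ∈ N) (hx' : τ.condExp N a * x' + x' * τ.condExp N b = τ.condExp N y) :
    τ.reTrace (τ.condExp N y * x') ≤ τ.reTrace (y * x) :=
  calc τ.reTrace (τ.condExp N y * x')
      = τ.sylvesterForm (τ.condExp N a) (τ.condExp N b) (τ.condExp N y) x' :=
        (τ.sylvesterForm_eq_of_sylvester (τ.condExp_isSelfAdjoint N (.of_nonneg ha))
          (τ.condExp_isSelfAdjoint N (.of_nonneg hb)) (τ.condExp_isSelfAdjoint N hy) hx').symm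
    _ = τ.sylvesterForm a b y x' := τ.sylvesterForm_condExp N a b y hx'N
    _ ≤ τ.reTrace (y * x) := τ.sylvesterForm_le_of_sylvester ha hb hy hx x'

end Sylvester

section RelativeEntropy

variable {M : Type*} [CStarAlgebra M] [PartialOrder M] [StarOrderedRing M] [FiniteDimensional ℂ M]

/-- The interpolation from `τ (ρ log σ)` at `s = 0` to `τ (ρ log ρ)` at `s = 1`, in which the
logarithm is applied to `(1 - s) L_σ + s R_ρ`, a combination of the commuting operators of left
multiplication by `σ` and right multiplication by `ρ`. -/
noncomputable def interpLog (τ : FaithfulTrace M) (ρ σ : M) (s : ℝ) : ℝ :=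
  τ.reTrace (doubleCFC σ ρ fun t r => r * Real.log ((1 - s) * t + s * r))

theorem interpLog_zero (τ : FaithfulTrace M) {ρ : M} (hρ : IsSelfAdjoint ρ) (σ : M) :
    τ.interpLog ρ σ 0 = τ.reTrace (ρ * CFC.log σ) := by
  simp only [interpLog, sub_zero, one_mul, zero_mul, add_zero, mul_comm _ (Real.log _)]
  rw [doubleCFC_mul, cfc_id' ℝ ρ, reTrace_mul_comm, CFC.log]

theorem interpLog_one (τ : FaithfulTrace M) {ρ σ : M} (hρ : IsSelfAdjoint ρ)
    (hσ : IsSelfAdjoint σ) : τ.interpLog ρ σ 1 = τ.reTrace (ρ * CFC.log ρ) := by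
  simp only [interpLog, sub_self, zero_mul, zero_add, one_mul]
  rw [doubleCFC_snd hσ ρ fun r => r * Real.log r, cfc_mul_eq_mul_cfc, cfc_id' ℝ ρ, CFC.log]

theorem hasDerivAt_interpLog (τ : FaithfulTrace M) {ρ σ : M} (hρ : 0 ≤ ρ)
    (hσ : IsStrictlyPositive σ) {s : ℝ} (hs0 : 0 ≤ s) (hs1 : s < 1) :
    HasDerivAt (τ.interpLog ρ σ)
      ((1 - s)⁻¹ * (τ.reTrace (ρ * sylvesterSol σ ρ s) - τ.reTrace ρ)) s := by
  have hρs := IsSelfAdjoint.of_nonneg hρ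
  have hderiv : HasDerivAt (fun s => doubleCFC σ ρ fun t r => r * Real.log ((1 - s) * t + s * r))
      (doubleCFC σ ρ fun t r => (1 - s)⁻¹ * (r / ((1 - s) * t + s * r) * r - r)) s := by
    refine hasDerivAt_doubleCFC fun t ht r hr => ?_
    have hd : (1 - s) * t + s * r ≠ 0 := (add_pos_of_pos_of_nonneg
      (mul_pos (sub_pos.2 hs1) (hσ.spectrum_pos ht))
      (mul_nonneg hs0 (spectrum_nonneg_of_nonneg hρ hr))).ne'
    have hlin : HasDerivAt (fun s => (1 - s) * t + s * r) (r - t) s :=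
      ((((hasDerivAt_id' s).const_sub 1).mul_const t).fun_add
        ((hasDerivAt_id' s).mul_const r)).congr_deriv (by ring)
    refine ((hlin.log hd).const_mul r).congr_deriv ?_
    rw [eq_inv_mul_iff_mul_eq₀ (sub_pos.2 hs1).ne']
    linear_combination -r * div_self hd
  have hsol : (doubleCFC σ ρ fun t r => (1 - s)⁻¹ * (r / ((1 - s) * t + s * r) * r - r)) =
      (1 - s)⁻¹ • (sylvesterSol σ ρ s * ρ - ρ) := by
    have hid := (doubleCFC_snd hσ.isSelfAdjoint ρ fun r => r).trans (cfc_id' ℝ ρ)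
    nth_rewrite 4 [← hid]
    rw [sylvesterSol, doubleCFC_mul_right _ hρs, ← map_sub, ← map_smul]
    rfl
  rw [hsol] at hderiv
  refine (τ.reTrace.hasFDerivAt.comp_hasDerivAt s hderiv).congr_deriv ?_
  rw [map_smul, map_sub, τ.reTrace_mul_comm _ ρ, smul_eq_mul]

theorem continuousOn_interpLog (τ : FaithfulTrace M) {ρ σ : M} (hρ : 0 ≤ ρ)
    (hσ : IsStrictlyPositive σ) : ContinuousOn (τ.interpLog ρ σ) (Set.Icc 0 1) := by
  refine τ.reTrace.continuous.comp_continuousOn (continuousOn_doubleCFC fun t ht r hr => ?_)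
  rcases (spectrum_nonneg_of_nonneg hρ hr).eq_or_lt with rfl | hr0
  · simpa only [zero_mul] using continuousOn_const
  have hpos : ∀ s ∈ Set.Icc (0 : ℝ) 1, (1 - s) * t + s * r ≠ 0 := fun s hs =>
    ((convex_Ioi (0 : ℝ)) (hσ.spectrum_pos ht) hr0 (sub_nonneg.2 hs.2) hs.1
      (sub_add_cancel 1 s)).ne'
  exact continuousOn_const.mul (ContinuousOn.log (by fun_prop) hpos)

/-- The relative entropy `D(ρ‖σ) = τ (ρ (log ρ - log σ))`. It is the usual one only for strictly
positive `σ`: otherwise `CFC.log σ` vanishes on the kernel of `σ`. -/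
noncomputable def relEntropy (τ : FaithfulTrace M) (ρ σ : M) : ℝ :=
  τ.reTrace (ρ * (CFC.log ρ - CFC.log σ))

theorem relEntropy_condExp_le (τ : FaithfulTrace M) (N : StarSubalgebra ℂ M) {ρ σ : M}
    (hρ : 0 ≤ ρ) (hσ : IsStrictlyPositive σ) :
    τ.relEntropy (τ.condExp N ρ) (τ.condExp N σ) ≤ τ.relEntropy ρ σ := by
  have hρN := τ.condExp_nonneg N hρ
  have hσN := τ.condExp_isStrictlyPositive N hσ
  have hmono : MonotoneOn
      (fun s => τ.interpLog ρ σ s - τ.interpLog (τ.condExp N ρ) (τ.condExp N σ) s)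
      (Set.Icc 0 1) := by
    refine monotoneOn_of_hasDerivWithinAt_nonneg (convex_Icc 0 1)
      ((τ.continuousOn_interpLog hρ hσ).sub (τ.continuousOn_interpLog hρN hσN))
      (f' := fun s => (1 - s)⁻¹ * (τ.reTrace (ρ * sylvesterSol σ ρ s) - τ.reTrace ρ) -
        (1 - s)⁻¹ * (τ.reTrace (τ.condExp N ρ * sylvesterSol (τ.condExp N σ) (τ.condExp N ρ) s) -
          τ.reTrace (τ.condExp N ρ)))
      (fun s hs => ?_) fun s hs => ?_ <;> rw [interior_Icc] at hs
    · exact ((τ.hasDerivAt_interpLog hρ hσ hs.1.le hs.2).sub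
        (τ.hasDerivAt_interpLog hρN hσN hs.1.le hs.2)).hasDerivWithinAt
    · have hs1 : 0 ≤ 1 - s := sub_nonneg.2 hs.2.le
      have hle := τ.reTrace_condExp_mul_le_of_sylvester N (smul_nonneg hs1 hσ.nonneg)
        (smul_nonneg hs.1.le hρ) (.of_nonneg hρ)
        (smul_mul_sylvesterSol_add hσ hρ hs.1.le hs.2)
        (sylvesterSol_mem (τ.condExp_mem N σ) (τ.condExp_mem N ρ) s)
        (by simpa only [LinearMap.map_smul_of_tower] using
          smul_mul_sylvesterSol_add hσN hρN hs.1.le hs.2)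
      rw [reTrace_condExp, ← mul_sub]
      exact mul_nonneg (inv_nonneg.2 hs1) (by linarith)
  have h01 := hmono (Set.left_mem_Icc.2 zero_le_one) (Set.right_mem_Icc.2 zero_le_one) zero_le_one
  have hρs := IsSelfAdjoint.of_nonneg hρ
  have hρNs := IsSelfAdjoint.of_nonneg hρN
  simp only [interpLog_zero, interpLog_one, hρs, hρNs, hσ.isSelfAdjoint, hσN.isSelfAdjoint] at h01
  simp only [relEntropy, mul_sub, map_sub]
  linarith

end RelativeEntropy

section Entropy

variable {M : Type*} [CStarAlgebra M] [PartialOrder M] [StarOrderedRing M]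

theorem continuousOn_entropy (τ : FaithfulTrace M) :
    ContinuousOn τ.entropy {ρ | IsSelfAdjoint ρ} :=
  τ.reTrace.continuous.comp_continuousOn (ContinuousOn.cfc_of_mem_nhdsSet (s := Set.univ)
    Real.negMulLog Filter.univ_mem continuousOn_id (fun _ h => h)
    Real.continuous_negMulLog.continuousOn)

theorem relEntropy_sub_le_of_le_smul (τ : FaithfulTrace M) {ρ σ ω : M} {c : ℝ} (hρ : 0 ≤ ρ)
    (hσ : IsStrictlyPositive σ) (hω : IsStrictlyPositive ω) (hc : 0 < c) (h : σ ≤ c • ω) :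
    τ.relEntropy ρ ω - τ.reTrace ρ * Real.log c ≤ τ.relEntropy ρ σ := by
  have hlog := τ.reTrace_mul_le_reTrace_mul hρ (CFC.log_le_log h hσ)
  rw [CFC.log_smul' ω hc, Algebra.algebraMap_eq_smul_one, mul_add, mul_smul_comm, mul_one, map_add,
    map_smul, smul_eq_mul] at hlog
  simp only [relEntropy, mul_sub, map_sub]
  linarith

variable [FiniteDimensional ℂ M]

theorem reTrace_mul_log_self (τ : FaithfulTrace M) {ρ : M} (hρ : IsSelfAdjoint ρ) :
    τ.reTrace (ρ * CFC.log ρ) = -τ.entropy ρ := by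
  have hneg : ρ * CFC.log ρ = -cfc Real.negMulLog ρ := by
    rw [← cfc_neg, Real.negMulLog_eq_neg]
    simp only [neg_neg]
    rw [cfc_mul_eq_mul_cfc, cfc_id' ℝ ρ, CFC.log]
  rw [hneg, map_neg]
  rfl

theorem relEntropy_condExp_self (τ : FaithfulTrace M) (N : StarSubalgebra ℂ M) {ρ : M}
    (hρ : IsSelfAdjoint ρ) :
    τ.relEntropy ρ (τ.condExp N ρ) = τ.entropy (τ.condExp N ρ) - τ.entropy ρ := by
  have hmem : CFC.log (τ.condExp N ρ) ∈ N := cfc_mem (𝕜' := ℂ) Real.log (τ.condExp_mem N ρ)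
  have hlog : τ.reTrace (ρ * CFC.log (τ.condExp N ρ)) = -τ.entropy (τ.condExp N ρ) := by
    rw [← τ.reTrace_mul_log_self (τ.condExp_isSelfAdjoint N hρ), reTrace_condExp_mul,
      τ.condExp_of_mem N hmem]
  rw [relEntropy, mul_sub, map_sub, hlog, τ.reTrace_mul_log_self hρ]
  ring

end Entropy

section Overlap

variable {M : Type*} [CStarAlgebra M] [PartialOrder M] [StarOrderedRing M] [FiniteDimensional ℂ M]

theorem exists_norm_le_mul_reTrace (τ : FaithfulTrace M) :
    ∃ C, ∀ x : M, 0 ≤ x → ‖x‖ ≤ C * τ.reTrace x := by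
  have := FiniteDimensional.proper ℂ M
  have hcpt : IsCompact (Metric.sphere (0 : M) 1 ∩ {x | 0 ≤ x}) :=
    (isCompact_sphere 0 1).inter_right CStarAlgebra.isClosed_nonneg
  obtain ⟨m, hm, hle⟩ := hcpt.exists_forall_le' τ.reTrace.continuous.continuousOn
    fun x hx => τ.reTrace_pos hx.2 (ne_zero_of_mem_unit_sphere ⟨x, hx.1⟩)
  refine ⟨m⁻¹, fun x hx => ?_⟩
  rcases eq_or_ne x 0 with rfl | hx0
  · simp
  have hunit := hle (‖x‖⁻¹ • x)
    ⟨by simp [norm_smul, hx0], smul_nonneg (inv_nonneg.2 (norm_nonneg x)) hx⟩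
  rw [map_smul, smul_eq_mul, inv_mul_eq_div, le_div_iff₀ (norm_pos_iff.2 hx0)] at hunit
  rwa [inv_mul_eq_div, le_div_iff₀' hm]

theorem mem_overlapSet_iff {τ : FaithfulTrace M} {R A B : StarSubalgebra ℂ M} {t : ℝ} :
    t ∈ τ.overlapSet R A B ↔ ∃ a ∈ A, ∃ b ∈ B, 0 ≤ a ∧ 0 ≤ b ∧ τ.condExp R a = 1 ∧
      τ.reTrace b = 1 ∧ τ.reTrace (a * b) = t := by
  refine exists_congr fun a => and_congr_right fun _ => exists_congr fun b =>
    and_congr_right fun _ => and_congr_right fun ha => and_congr_right fun hb =>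
    and_congr_right fun _ => and_congr ?_ ?_
  · change τ.toFun b = 1 ↔ _
    rw [τ.apply_eq_reTrace hb, Complex.ofReal_eq_one]
  · change τ.toFun (a * b) = t ↔ _
    rw [τ.apply_mul_eq_reTrace ha hb, Complex.ofReal_inj]

variable (τ : FaithfulTrace M) (R A B : StarSubalgebra ℂ M)

theorem one_mem_overlapSet [Nontrivial M] : (1 : ℝ) ∈ τ.overlapSet R A B := by
  have hpos := τ.reTrace_pos zero_le_one (one_ne_zero (α := M))
  have hnorm : τ.reTrace ((τ.reTrace 1)⁻¹ • (1 : M)) = 1 := by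
    rw [map_smul, smul_eq_mul, inv_mul_cancel₀ hpos.ne']
  refine mem_overlapSet_iff.2 ⟨1, one_mem A, _,
    B.toSubmodule.smul_of_tower_mem (τ.reTrace 1)⁻¹ (one_mem B), zero_le_one,
    smul_nonneg (inv_nonneg.2 hpos.le) zero_le_one, τ.condExp_one R, hnorm, ?_⟩
  rw [one_mul, hnorm]

theorem bddAbove_overlapSet : BddAbove (τ.overlapSet R A B) := by
  obtain ⟨C, hC⟩ := τ.exists_norm_le_mul_reTrace
  refine ⟨C * τ.reTrace 1, fun t ht => ?_⟩
  obtain ⟨a, -, b, -, ha, hb, haR, hb1, rfl⟩ := mem_overlapSet_iff.1 ht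
  calc τ.reTrace (a * b) = τ.reTrace (b * a) := τ.reTrace_mul_comm a b
    _ ≤ τ.reTrace (b * algebraMap ℝ M ‖a‖) := τ.reTrace_mul_le_reTrace_mul hb
        (IsSelfAdjoint.le_algebraMap_norm_self (.of_nonneg ha))
    _ = ‖a‖ := by
        rw [Algebra.algebraMap_eq_smul_one, mul_smul_comm, mul_one, map_smul, hb1, smul_eq_mul,
          mul_one]
    _ ≤ C * τ.reTrace a := hC a ha
    _ = C * τ.reTrace 1 := by rw [← τ.reTrace_condExp R a, haR]

theorem isLUB_overlap [Nontrivial M] : IsLUB (τ.overlapSet R A B) (τ.overlap R A B) :=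
  isLUB_csSup ⟨1, τ.one_mem_overlapSet R A B⟩ (τ.bddAbove_overlapSet R A B)

theorem one_le_overlap [Nontrivial M] : 1 ≤ τ.overlap R A B :=
  (τ.isLUB_overlap R A B).1 (τ.one_mem_overlapSet R A B)

variable {τ R A B}

theorem reTrace_mul_le_overlap_mul {a b : M} (haA : a ∈ A) (hbB : b ∈ B) (ha : 0 ≤ a)
    (hb : 0 ≤ b) (haR : τ.condExp R a = 1) :
    τ.reTrace (a * b) ≤ τ.overlap R A B * τ.reTrace b := by
  rcases eq_or_ne b 0 with rfl | hb0
  · simp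
  have hpos := τ.reTrace_pos hb hb0
  have hle : τ.reTrace (a * (τ.reTrace b)⁻¹ • b) ≤ τ.overlap R A B :=
    le_csSup (τ.bddAbove_overlapSet R A B) <| mem_overlapSet_iff.2
      ⟨a, haA, _, B.toSubmodule.smul_of_tower_mem (τ.reTrace b)⁻¹ hbB, ha,
        smul_nonneg (inv_nonneg.2 hpos.le) hb, haR,
        by rw [map_smul, smul_eq_mul, inv_mul_cancel₀ hpos.ne'], rfl⟩
  rwa [mul_smul_comm, map_smul, smul_eq_mul, inv_mul_eq_div, div_le_iff₀ hpos] at hle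

theorem reTrace_mul_le_overlap_mul_condExp (hRA : R ≤ A) (hRB : R ≤ B) {a b : M} (haA : a ∈ A)
    (hbB : b ∈ B) (ha : 0 ≤ a) (hb : 0 ≤ b) (haR : IsStrictlyPositive (τ.condExp R a)) :
    τ.reTrace (a * b) ≤ τ.overlap R A B * τ.reTrace (b * τ.condExp R a) := by
  set r := τ.condExp R a with hr
  set u := r ^ (1 / 2 : ℝ) with hu
  set v := r ^ (-(1 / 2) : ℝ)
  have huR : u ∈ R := rpow_mem haR.nonneg (τ.condExp_mem R a) _
  have hvR : v ∈ R := rpow_mem haR.nonneg (τ.condExp_mem R a) _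
  have hus : IsSelfAdjoint u := .of_nonneg CFC.rpow_nonneg
  have hvs : IsSelfAdjoint v := .of_nonneg CFC.rpow_nonneg
  have huv : u * v = 1 := CFC.rpow_mul_rpow_neg _ haR
  have hvu : v * u = 1 := CFC.rpow_neg_mul_rpow _ haR
  have huu : u * u = r := by
    rw [hu, ← CFC.rpow_add haR.isUnit, add_halves, CFC.rpow_one r]
  have hvrv : v * r * v = 1 := CFC.conjugate_rpow_neg_one_half r
  have hle := reTrace_mul_le_overlap_mul (τ := τ) (R := R) (a := v * a * v) (b := u * b * u)
    (mul_mem (mul_mem (hRA hvR) haA) (hRA hvR)) (mul_mem (mul_mem (hRB huR) hbB) (hRB huR))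
    (hvs.conjugate_nonneg ha) (hus.conjugate_nonneg hb)
    (by rw [τ.condExp_mul_mul R hvR hvR, ← hr, hvrv])
  have hprod : τ.reTrace (v * a * v * (u * b * u)) = τ.reTrace (a * b) := by
    rw [τ.reTrace_mul_comm]
    calc τ.reTrace (u * b * u * (v * a * v)) = τ.reTrace (u * b * (u * v) * a * v) := by
          simp only [mul_assoc]
      _ = τ.reTrace (u * (b * a * v)) := by simp only [huv, mul_one, mul_assoc]
      _ = τ.reTrace (b * a) := by rw [τ.reTrace_mul_comm, mul_assoc, hvu, mul_one]
      _ = τ.reTrace (a * b) := τ.reTrace_mul_comm b a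
  have htrace : τ.reTrace (u * b * u) = τ.reTrace (b * r) := by
    rw [mul_assoc, τ.reTrace_mul_comm, mul_assoc, huu]
  rwa [hprod, htrace] at hle

theorem condExp_condExp_le_overlap_smul (hRA : R ≤ A) (hRB : R ≤ B) {ρ : M}
    (hρ : IsStrictlyPositive ρ) :
    τ.condExp B (τ.condExp A ρ) ≤ τ.overlap R A B • τ.condExp R ρ := by
  have hA := τ.condExp_isStrictlyPositive A hρ
  have hRA' := τ.condExp_condExp_of_le hRA ρ
  have hmem : τ.overlap R A B • τ.condExp R ρ ∈ B :=
    B.toSubmodule.smul_of_tower_mem _ (hRB (τ.condExp_mem R ρ))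
  rw [← sub_nonneg]
  refine τ.nonneg_of_reTrace_mul_nonneg (sub_mem hmem (τ.condExp_mem B _))
    (((IsSelfAdjoint.all (τ.overlap R A B)).smul (τ.condExp_isSelfAdjoint R hρ.isSelfAdjoint)).sub
      (τ.condExp_isSelfAdjoint B hA.isSelfAdjoint)) fun b hb hb0 => ?_
  have hle := reTrace_mul_le_overlap_mul_condExp hRA hRB (τ.condExp_mem A ρ) hb hA.nonneg hb0
    (hRA' ▸ τ.condExp_isStrictlyPositive R hρ)
  rw [mul_sub, map_sub, sub_nonneg, τ.reTrace_mul_condExp B _ hb, mul_smul_comm, map_smul,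
    smul_eq_mul, τ.reTrace_mul_comm, ← hRA']
  exact hle

end Overlap

section Main

variable {M : Type*} [CStarAlgebra M] [PartialOrder M] [StarOrderedRing M] [FiniteDimensional ℂ M]
  {τ : FaithfulTrace M} {R A B : StarSubalgebra ℂ M}

theorem condExp_comp_comm (h : τ.condExp B ∘ₗ τ.condExp A = τ.condExp R) :
    τ.condExp A ∘ₗ τ.condExp B = τ.condExp R := by
  ext y
  refine τ.eq_of_reTrace_mul_eq (N := ⊤) trivial trivial fun x _ => ?_
  rw [LinearMap.comp_apply, ← reTrace_condExp_mul, ← reTrace_condExp_mul, ← reTrace_condExp_mul,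
    ← h, LinearMap.comp_apply]

theorem condExp_comp_eq_of_overlap_eq_one (hRA : R ≤ A) (hRB : R ≤ B)
    (h : τ.overlap R A B = 1) : τ.condExp B ∘ₗ τ.condExp A = τ.condExp R := by
  have hpos {ρ : M} (hρ : IsStrictlyPositive ρ) :
      τ.condExp B (τ.condExp A ρ) = τ.condExp R ρ := by
    have hle := condExp_condExp_le_overlap_smul (τ := τ) hRA hRB hρ
    rw [h, one_smul, ← sub_nonneg] at hle
    exact (sub_eq_zero.1 (τ.eq_zero_of_reTrace_eq_zero hle
      (by simp only [map_sub, reTrace_condExp, sub_self]))).symm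
  refine LinearMap.ext_on (s := {ρ : M | 0 ≤ ρ}) CStarAlgebra.span_nonneg fun ρ hρ => ?_
  have hone := hpos (isStrictlyPositive_one.nonneg_add hρ)
  simpa only [LinearMap.comp_apply, map_add, condExp_one, add_left_inj] using hone

variable [Nontrivial M]

theorem entropy_add_sub_le_of_isStrictlyPositive (hRA : R ≤ A) (hRB : R ≤ B) {ρ : M}
    (hρ : IsStrictlyPositive ρ) :
    τ.entropy ρ + τ.entropy (τ.condExp R ρ) - τ.reTrace ρ * Real.log (τ.overlap R A B) ≤
      τ.entropy (τ.condExp A ρ) + τ.entropy (τ.condExp B ρ) := by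
  have hA := τ.condExp_isStrictlyPositive A hρ
  have hB := τ.condExp_isStrictlyPositive B hρ
  have hc : 0 < τ.overlap R A B := zero_lt_one.trans_le (τ.one_le_overlap R A B)
  have hchain :=
    calc τ.entropy (τ.condExp R ρ) - τ.entropy (τ.condExp B ρ) -
          τ.reTrace ρ * Real.log (τ.overlap R A B)
        = τ.relEntropy (τ.condExp B ρ) (τ.condExp R ρ) -
          τ.reTrace (τ.condExp B ρ) * Real.log (τ.overlap R A B) := by
          rw [reTrace_condExp, ← τ.condExp_condExp_of_le hRB ρ,
            τ.relEntropy_condExp_self R hB.isSelfAdjoint]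
      _ ≤ τ.relEntropy (τ.condExp B ρ) (τ.condExp B (τ.condExp A ρ)) :=
          τ.relEntropy_sub_le_of_le_smul hB.nonneg (τ.condExp_isStrictlyPositive B hA)
            (τ.condExp_isStrictlyPositive R hρ) hc (condExp_condExp_le_overlap_smul hRA hRB hρ)
      _ ≤ τ.relEntropy ρ (τ.condExp A ρ) := τ.relEntropy_condExp_le B hρ.nonneg hA
      _ = τ.entropy (τ.condExp A ρ) - τ.entropy ρ :=
          τ.relEntropy_condExp_self A hρ.isSelfAdjoint
  linarith

open Filter Topology

theorem entropy_add_sub_le (hRA : R ≤ A) (hRB : R ≤ B) {ρ : M} (hρ : 0 ≤ ρ) :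
    τ.entropy ρ + τ.entropy (τ.condExp R ρ) - τ.reTrace ρ * Real.log (τ.overlap R A B) ≤
      τ.entropy (τ.condExp A ρ) + τ.entropy (τ.condExp B ρ) := by
  have hpath {σ : M} : Tendsto (fun ε : ℝ => σ + ε • 1) (𝓝[>] 0) (𝓝 σ) := by
    have hcont : Continuous fun ε : ℝ => σ + ε • (1 : M) := by fun_prop
    simpa using (hcont.tendsto 0).mono_left nhdsWithin_le_nhds
  have hentropy {σ : M} (hσ : IsSelfAdjoint σ) :
      Tendsto (fun ε : ℝ => τ.entropy (σ + ε • 1)) (𝓝[>] 0) (𝓝 (τ.entropy σ)) :=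
    (τ.continuousOn_entropy σ hσ).tendsto.comp <| tendsto_nhdsWithin_iff.2
      ⟨hpath, .of_forall fun ε => hσ.add ((IsSelfAdjoint.all ε).smul (IsSelfAdjoint.one M))⟩
  have hcond (N : StarSubalgebra ℂ M) :
      Tendsto (fun ε : ℝ => τ.entropy (τ.condExp N (ρ + ε • 1))) (𝓝[>] 0)
        (𝓝 (τ.entropy (τ.condExp N ρ))) := by
    simpa only [condExp_add_smul_one] using
      hentropy (τ.condExp_isSelfAdjoint N (.of_nonneg hρ))
  have htrace : Tendsto (fun ε : ℝ => τ.reTrace (ρ + ε • 1)) (𝓝[>] 0) (𝓝 (τ.reTrace ρ)) :=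
    (τ.reTrace.continuous.tendsto ρ).comp hpath
  refine le_of_tendsto_of_tendsto
    (((hentropy (.of_nonneg hρ)).add (hcond R)).sub (htrace.mul_const _))
    ((hcond A).add (hcond B)) ?_
  filter_upwards [self_mem_nhdsWithin] with ε hε
  exact entropy_add_sub_le_of_isStrictlyPositive hRA hRB
    ((isStrictlyPositive_one.smul hε).nonneg_add hρ)

theorem overlap_eq_one_of_condExp_comp (hAB : τ.condExp A ∘ₗ τ.condExp B = τ.condExp R) :
    τ.overlap R A B = 1 := by
  refine le_antisymm ((τ.isLUB_overlap R A B).2 fun t ht => ?_) (τ.one_le_overlap R A B)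
  obtain ⟨a, haA, b, hbB, -, -, haR, hb1, rfl⟩ := mem_overlapSet_iff.1 ht
  have hbR : τ.condExp A b = τ.condExp R b := by
    rw [← hAB, LinearMap.comp_apply, τ.condExp_of_mem B hbB]
  rw [← τ.reTrace_mul_condExp A b haA, hbR, ← reTrace_condExp_mul, haR, one_mul, hb1]

end Main

end FaithfulTrace

/-- `M` is a nonzero finite-dimensional C*-algebra, i.e. (up to isomorphism) a finite-dimensional
von Neumann algebra; `StarSubalgebra`s contain the unit of `M`. -/
theorem corollary3p3 {M : Type*} [CStarAlgebra M] [PartialOrder M] [StarOrderedRing M]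
    [FiniteDimensional ℂ M] [Nontrivial M] (τ : FaithfulTrace M)
    (R A B : StarSubalgebra ℂ M) (hRA : R ≤ A) (hRB : R ≤ B) :
    IsLUB (τ.overlapSet R A B) (τ.overlap R A B) ∧
    (∀ ρ : M, τ.IsDensity ρ →
      τ.entropy ρ + τ.entropy (τ.condExp R ρ) + Real.log (1 / τ.overlap R A B) ≤
        τ.entropy (τ.condExp A ρ) + τ.entropy (τ.condExp B ρ)) ∧
    (τ.overlap R A B = 1 ↔
      τ.condExp A ∘ₗ τ.condExp B = τ.condExp R ∧ τ.condExp B ∘ₗ τ.condExp A = τ.condExp R) := by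
  refine ⟨τ.isLUB_overlap R A B, fun ρ ⟨hρ, hρ1⟩ => ?_, fun h => ?_,
    fun h => FaithfulTrace.overlap_eq_one_of_condExp_comp h.1⟩
  · have htrace : τ.reTrace ρ = 1 := congrArg Complex.re hρ1
    have hentropy := FaithfulTrace.entropy_add_sub_le (τ := τ) hRA hRB hρ
    rwa [htrace, one_mul, sub_eq_add_neg, ← Real.log_inv, ← one_div] at hentropy
  · have hBA := FaithfulTrace.condExp_comp_eq_of_overlap_eq_one hRA hRB h
    exact ⟨FaithfulTrace.condExp_comp_comm hBA, hBA⟩
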